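/- Let $H$ be a complex Hilbert space and let $T$ be a locally compact Hausdorff space with a Radon probability measure $\mu$. Let $J,K\subseteq\mathbb{R}$ be intervals with $0\in J$. Let $f:J\to\mathbb{R}$ be operator convex with $f(0)\le 0$, and let $h:K\to\mathbb{R}$ be operator concave with $h(x)>0$ for all $x\in K$. (A continuous function $f$ on an interval $J$ is operator convex if $f(\lambda X+(1-\lambda)Y)\le\lambda f(X)+(1-\lambda)f(Y)$ for all $\lambda\in[0,1]$ and all bounded self-adjoint operators $X,Y$ on any complex Hilbert space with spectra in $J$; $h$ is operator concave if $-h$ is operator convex.) For bounded self-adjoint operators $X,Y$ on $H$ such that the spectrum of $Y$ lies in $K$ and the spectrum of $h(Y)^{-1/2}Xh(Y)^{-1/2}$ lies in $J$, put $$(f\Delta h)(X,Y):=h(Y)^{1/2}f\bigl(h(Y)^{-1/2}Xh(Y)^{-1/2}\bigr)h(Y)^{1/2}.$$ Let $\widetilde A=(A_t)_{t\in T}$ and $\widetilde B=(B_t)_{t\in T}$ be norm continuous fields of bounded self-adjoint operators on $H$ such that, for every $t\in T$, the spectrum of $B_t$ lies in $K$ and the spectrum of $h(B_t)^{-1/2}A_th(B_t)^{-1/2}$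 lies in $J$. Assume that the functions $t\mapsto A_t$, $t\mapsto B_t$ and $t\mapsto (f\Delta h)(A_t,B_t)$ are (Bochner) integrable with respect to $\mu$, and put $A=\int_TA_t\,d\mu(t)$, $B=\int_TB_t\,d\mu(t)$ and $$(f\nabla h)(\widetilde A,\widetilde B):=\int_T h(B_t)^{1/2}f\bigl(h(B_t)^{-1/2}A_th(B_t)^{-1/2}\bigr)h(B_t)^{1/2}\,d\mu(t).$$ Then the spectrum of $B$ lies in $K$ and the spectrum of $h(B)^{-1/2}Ah(B)^{-1/2}$ lies in $J$, so that $(f\Delta h)(A,B)$ is defined, and $$(f\Delta h)(A,B)\le (f\nabla h)(\widetilde A,\widetilde B).$$ -/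

import Mathlib

open MeasureTheory

universe u

/-- A real function `f` is operator convex on the interval `J`: it is continuous on `J`, and
`f (l A + (1 - l) B) ≤ l f(A) + (1 - l) f(B)` in the Loewner order, for all self-adjoint bounded
operators `A`, `B` on an arbitrary complex Hilbert space with spectra contained in `J` and all
`l ∈ [0, 1]`. Here `f(A)` is the continuous functional calculus `cfc f A`. -/
def OperatorConvexOn (J : Set ℝ) (f : ℝ → ℝ) : Prop :=
  ContinuousOn f J ∧
    ∀ (H : Type u) [NormedAddCommGroup H] [InnerProductSpace ℂ H] [CompleteSpace H]
      (A B : H →L[ℂ] H), IsSelfAdjoint A → IsSelfAdjoint B →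
      spectrum ℝ A ⊆ J → spectrum ℝ B ⊆ J → ∀ l ∈ Set.Icc (0 : ℝ) 1,
        cfc f (l • A + (1 - l) • B) ≤ l • cfc f A + (1 - l) • cfc f B

/-- `f` is operator concave on `J` if `-f` is operator convex on `J`. -/
def OperatorConcaveOn (J : Set ℝ) (f : ℝ → ℝ) : Prop :=
  OperatorConvexOn.{u} J (fun x => -f x)

section

variable {H : Type u} [NormedAddCommGroup H] [InnerProductSpace ℂ H] [CompleteSpace H]

/-- The operator `h(B)^{-1/2} A h(B)^{-1/2}`, the non-commutative version of `A / h(B)`. -/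
noncomputable def opQuotient (h : ℝ → ℝ) (A B : H →L[ℂ] H) : H →L[ℂ] H :=
  cfc h B ^ (-(1 / 2) : ℝ) * A * cfc h B ^ (-(1 / 2) : ℝ)

/-- The generalized operator perspective
`(f Δ h)(A, B) = h(B)^{1/2} f(h(B)^{-1/2} A h(B)^{-1/2}) h(B)^{1/2}`. -/
noncomputable def perspectiveDelta (f h : ℝ → ℝ) (A B : H →L[ℂ] H) : H →L[ℂ] H :=
  cfc h B ^ (1 / 2 : ℝ) * cfc f (opQuotient h A B) * cfc h B ^ (1 / 2 : ℝ)

/-- The functional `(f ∇ h)(Ã, B̃)` of two fields of operators: the Bochner integral of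
`h(B_t)^{1/2} f(h(B_t)^{-1/2} A_t h(B_t)^{-1/2}) h(B_t)^{1/2}` with respect to `μ`. -/
noncomputable def perspectiveNabla {T : Type*} [MeasurableSpace T] (μ : Measure T)
    (f h : ℝ → ℝ) (A B : T → H →L[ℂ] H) : H →L[ℂ] H :=
  ∫ t, cfc h (B t) ^ (1 / 2 : ℝ) * cfc f (opQuotient h (A t) (B t)) *
    cfc h (B t) ^ (1 / 2 : ℝ) ∂μ

end

/-! The perspective is jointly convex on the pairs where it is defined. Writing `S i` for the
operators `h(B_i)` and `T` for `h` of the average, the coefficients `√w_i S_i^{1/2} T^{-1/2}`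
satisfy `∑ C_i* C_i ≤ 1` because `h` is operator concave. The Hansen–Pedersen inequality, where `f 0
≤ 0` absorbs the defect, then gives the claim after conjugation by `T^{1/2}`
(`OperatorConvexOn.perspective_sum_le`, `perspectiveDelta_convexOn`). Hence the epigraph is convex,
and the integral of a field of its points lies in its closure. Norm continuity of the perspective
(`continuousOn_perspectiveDelta`) turns this into the inequality, once the integrated pair is known
to lie in the domain. That membership is delicate since `J` and `K` need not be closed. Each
operator stays away from every strict bound of the interval by some margin, and the margins are
dominated below by a scalar field with positive integral. For `J` the margin is restated as `x h(B)
- A ≥ δ`, a condition on a jointly concave expression when `x ≥ 0`. -/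

/-! ### Spectral inclusion in an interval as order bounds. -/

section Spectrum

variable {H : Type*} [NormedAddCommGroup H] [InnerProductSpace ℂ H] [CompleteSpace H]

/-- For an interval `J`, the spectrum of a self-adjoint operator lies in `J` if and only if the
operator is uniformly strictly on the same side as `J` of every strict bound of `J`. -/
theorem IsSelfAdjoint.spectrum_subset_iff {J : Set ℝ} (hJ : J.OrdConnected) {a : H →L[ℂ] H}
    (ha : IsSelfAdjoint a) :
    spectrum ℝ a ⊆ J ↔
      (∀ x, (∀ j ∈ J, j < x) → ∃ ε > 0, a ≤ algebraMap ℝ (H →L[ℂ] H) (x - ε)) ∧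
      (∀ x, (∀ j ∈ J, x < j) → ∃ ε > 0, algebraMap ℝ (H →L[ℂ] H) (x + ε) ≤ a) := by
  have hc : IsCompact (spectrum ℝ a) := spectrum.isCompact a
  constructor
  · intro h
    rcases (spectrum ℝ a).eq_empty_or_nonempty with he | hne
    · refine ⟨fun x _ => ⟨1, one_pos, ?_⟩, fun x _ => ⟨1, one_pos, ?_⟩⟩
      · rw [le_algebraMap_iff_spectrum_le]; simp [he]
      · rw [algebraMap_le_iff_le_spectrum]; simp [he]
    · refine ⟨fun x hx => ?_, fun x hx => ?_⟩
      · obtain ⟨m, hm, hmax⟩ := hc.exists_isMaxOn hne continuousOn_id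
        refine ⟨x - m, sub_pos.2 (hx m (h hm)), ?_⟩
        rw [le_algebraMap_iff_spectrum_le]
        intro y hy
        have := hmax hy
        simp only [id, Set.mem_ofPred_eq] at this
        linarith
      · obtain ⟨m, hm, hmin⟩ := hc.exists_isMinOn hne continuousOn_id
        refine ⟨m - x, sub_pos.2 (hx m (h hm)), ?_⟩
        rw [algebraMap_le_iff_le_spectrum]
        intro y hy
        have := hmin hy
        simp only [id, Set.mem_ofPred_eq] at this
        linarith
  · rintro ⟨h1, h2⟩ x hx
    by_contra hxJ
    by_cases hu : ∀ j ∈ J, j < x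
    · obtain ⟨ε, hε, h⟩ := h1 x hu
      rw [le_algebraMap_iff_spectrum_le] at h
      linarith [h x hx]
    · push Not at hu
      obtain ⟨k, hk, hxk⟩ := hu
      have hl : ∀ j ∈ J, x < j := by
        intro j hj
        by_contra hjx
        exact hxJ (hJ.out hj hk ⟨not_lt.1 hjx, hxk⟩)
      obtain ⟨ε, hε, h⟩ := h2 x hl
      rw [algebraMap_le_iff_le_spectrum] at h
      linarith [h x hx]

theorem spectrum_convexCombination_subset {J : Set ℝ} (hJ : J.OrdConnected) {a b : H →L[ℂ] H}
    (ha : IsSelfAdjoint a) (hb : IsSelfAdjoint b) (haJ : spectrum ℝ a ⊆ J)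
    (hbJ : spectrum ℝ b ⊆ J) {s t : ℝ} (hs : 0 ≤ s) (ht : 0 ≤ t) (hst : s + t = 1) :
    spectrum ℝ (s • a + t • b) ⊆ J := by
  have hsa : IsSelfAdjoint (s • a + t • b) :=
    ((IsSelfAdjoint.all _).smul ha).add ((IsSelfAdjoint.all _).smul hb)
  rw [ha.spectrum_subset_iff hJ] at haJ
  rw [hb.spectrum_subset_iff hJ] at hbJ
  have hcomb : ∀ r : ℝ, s • algebraMap ℝ (H →L[ℂ] H) r + t • algebraMap ℝ (H →L[ℂ] H) r
      = algebraMap ℝ (H →L[ℂ] H) r := fun r => by rw [← add_smul, hst, one_smul]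
  have hmono : ∀ r r' : ℝ, r ≤ r' →
      algebraMap ℝ (H →L[ℂ] H) r ≤ algebraMap ℝ (H →L[ℂ] H) r' := fun r r' h =>
    algebraMap_mono _ h
  rw [hsa.spectrum_subset_iff hJ]
  refine ⟨fun x hx => ?_, fun x hx => ?_⟩
  · obtain ⟨ε₁, h₁, h₁'⟩ := haJ.1 x hx
    obtain ⟨ε₂, h₂, h₂'⟩ := hbJ.1 x hx
    refine ⟨min ε₁ ε₂, lt_min h₁ h₂, ?_⟩
    rw [← hcomb (x - min ε₁ ε₂)]
    gcongr
    · exact h₁'.trans (hmono _ _ (by linarith [min_le_left ε₁ ε₂]))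
    · exact h₂'.trans (hmono _ _ (by linarith [min_le_right ε₁ ε₂]))
  · obtain ⟨ε₁, h₁, h₁'⟩ := haJ.2 x hx
    obtain ⟨ε₂, h₂, h₂'⟩ := hbJ.2 x hx
    refine ⟨min ε₁ ε₂, lt_min h₁ h₂, ?_⟩
    rw [← hcomb (x + min ε₁ ε₂)]
    gcongr
    · exact (hmono _ _ (by linarith [min_le_left ε₁ ε₂])).trans h₁'
    · exact (hmono _ _ (by linarith [min_le_right ε₁ ε₂])).trans h₂'

end Spectrum

/-! ### Compressions and intertwining operators. -/

section Compression

open ContinuousLinearMap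

variable {H L : Type*} [NormedAddCommGroup H] [InnerProductSpace ℂ H] [CompleteSpace H]
  [NormedAddCommGroup L] [InnerProductSpace ℂ L] [CompleteSpace L]

theorem ContinuousLinearMap.adjoint_conj_mono {X Y : L →L[ℂ] L} (h : X ≤ Y) (V : H →L[ℂ] L) :
    adjoint V ∘L X ∘L V ≤ adjoint V ∘L Y ∘L V := by
  rw [ContinuousLinearMap.le_def] at h ⊢
  have := h.adjoint_conj V
  simpa [sub_comp, comp_sub] using this

theorem ContinuousLinearMap.isSelfAdjoint_adjoint_conj {X : L →L[ℂ] L} (h : IsSelfAdjoint X)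
    (V : H →L[ℂ] L) : IsSelfAdjoint (adjoint V ∘L X ∘L V) := h.adjoint_conj V

theorem ContinuousLinearMap.adjoint_conj_algebraMap {V : H →L[ℂ] L} (hV : adjoint V ∘L V = 1)
    (r : ℝ) : adjoint V ∘L (algebraMap ℝ (L →L[ℂ] L) r) ∘L V = algebraMap ℝ (H →L[ℂ] H) r := by
  ext x
  have := congrArg (fun T : H →L[ℂ] H => T x) hV
  simp only [comp_apply] at this
  simp [Algebra.algebraMap_eq_smul_one, this]

theorem spectrum_adjoint_conj_subset {J : Set ℝ} (hJ : J.OrdConnected) {X : L →L[ℂ] L}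
    (hX : IsSelfAdjoint X) (hXJ : spectrum ℝ X ⊆ J) {V : H →L[ℂ] L} (hV : adjoint V ∘L V = 1) :
    spectrum ℝ (adjoint V ∘L X ∘L V) ⊆ J := by
  rw [(isSelfAdjoint_adjoint_conj hX V).spectrum_subset_iff hJ]
  rw [hX.spectrum_subset_iff hJ] at hXJ
  refine ⟨fun x hx => ?_, fun x hx => ?_⟩
  · obtain ⟨ε, hε, h⟩ := hXJ.1 x hx
    exact ⟨ε, hε, (adjoint_conj_mono h V).trans_eq (adjoint_conj_algebraMap hV _)⟩
  · obtain ⟨ε, hε, h⟩ := hXJ.2 x hx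
    exact ⟨ε, hε, (adjoint_conj_algebraMap hV _).symm.trans_le (adjoint_conj_mono h V)⟩

omit [CompleteSpace H] [CompleteSpace L] in
theorem aeval_comp_of_comp_eq {Z : L →L[ℂ] L} {C : H →L[ℂ] H} {V : H →L[ℂ] L}
    (h : Z ∘L V = V ∘L C) (p : Polynomial ℝ) :
    Polynomial.aeval Z p ∘L V = V ∘L Polynomial.aeval C p := by
  have hpow : ∀ n : ℕ, (Z ^ n) ∘L V = V ∘L (C ^ n) := by
    intro n
    induction n with
    | zero => ext x; simp
    | succ n ih =>
      rw [pow_succ, pow_succ, ContinuousLinearMap.mul_def, ContinuousLinearMap.mul_def,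
        ContinuousLinearMap.comp_assoc, h, ← ContinuousLinearMap.comp_assoc, ih,
        ContinuousLinearMap.comp_assoc]
  induction p using Polynomial.induction_on' with
  | add p q hp hq => simp only [map_add, add_comp, comp_add, hp, hq]
  | monomial n r =>
    ext x
    have := congrArg (fun T : H →L[ℂ] L => T x) (hpow n)
    simp only [comp_apply] at this
    simp [Polynomial.aeval_monomial, Algebra.algebraMap_eq_smul_one, this]

/-- The continuous functional calculus respects intertwining operators. -/
theorem cfc_comp_of_comp_eq {J : Set ℝ} (hJ : J.OrdConnected) {f : ℝ → ℝ} (hf : ContinuousOn f J)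
    {Z : L →L[ℂ] L} {C : H →L[ℂ] H} (hZ : IsSelfAdjoint Z) (hC : IsSelfAdjoint C)
    (hZJ : spectrum ℝ Z ⊆ J) (hCJ : spectrum ℝ C ⊆ J) {V : H →L[ℂ] L}
    (h : Z ∘L V = V ∘L C) : cfc f Z ∘L V = V ∘L cfc f C := by
  set s := spectrum ℝ Z ∪ spectrum ℝ C with hs
  have hsc : IsCompact s := (spectrum.isCompact Z).union (spectrum.isCompact C)
  have hsJ : s ⊆ J := Set.union_subset hZJ hCJ
  -- Polynomial approximation needs one compact interval containing both spectra; for empty spectra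
  -- the empty interval `[1, 0]` serves.
  obtain ⟨a, b, hab, hIJ⟩ : ∃ a b, s ⊆ Set.Icc a b ∧ ContinuousOn f (Set.Icc a b) := by
    rcases s.eq_empty_or_nonempty with he | hne
    · exact ⟨1, 0, by simp [he], by simp⟩
    · obtain ⟨m, hm, hmin⟩ := hsc.exists_isMinOn hne continuousOn_id
      obtain ⟨M, hM, hmax⟩ := hsc.exists_isMaxOn hne continuousOn_id
      exact ⟨m, M, fun x hx => ⟨hmin hx, hmax hx⟩, hf.mono (hJ.out (hsJ hm) (hsJ hM))⟩
  have hfZ : ContinuousOn f (spectrum ℝ Z) := hf.mono hZJ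
  have hfC : ContinuousOn f (spectrum ℝ C) := hf.mono hCJ
  rw [← sub_eq_zero, ← norm_le_zero_iff]
  refine le_of_forall_pos_le_add fun δ hδ => ?_
  -- Two error terms of size `ε * ‖V‖` must fit into `δ`; the `+ 1` covers `V = 0`.
  set ε := δ / (2 * (‖V‖ + 1)) with hε
  have hV1 : 0 < ‖V‖ + 1 := by positivity
  have hεpos : 0 < ε := by positivity
  obtain ⟨p, hp⟩ := exists_polynomial_near_of_continuousOn a b f hIJ ε hεpos
  have e1 : ‖cfc f Z - Polynomial.aeval Z p‖ ≤ ε := by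
    rw [← cfc_polynomial p Z, ← cfc_sub f p.eval Z hfZ (by fun_prop)]
    refine norm_cfc_le hεpos.le fun x hx => ?_
    rw [Real.norm_eq_abs, abs_sub_comm]
    exact (hp x (hab (Or.inl hx))).le
  have e2 : ‖cfc f C - Polynomial.aeval C p‖ ≤ ε := by
    rw [← cfc_polynomial p C, ← cfc_sub f p.eval C hfC (by fun_prop)]
    refine norm_cfc_le hεpos.le fun x hx => ?_
    rw [Real.norm_eq_abs, abs_sub_comm]
    exact (hp x (hab (Or.inr hx))).le
  have key : cfc f Z ∘L V - V ∘L cfc f C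
      = (cfc f Z - Polynomial.aeval Z p) ∘L V - V ∘L (cfc f C - Polynomial.aeval C p) := by
    rw [sub_comp, comp_sub, aeval_comp_of_comp_eq h p]; abel
  rw [key]
  calc _ ≤ ‖(cfc f Z - Polynomial.aeval Z p) ∘L V‖ + ‖V ∘L (cfc f C - Polynomial.aeval C p)‖ :=
        norm_sub_le _ _
    _ ≤ ε * ‖V‖ + ‖V‖ * ε := by
        gcongr
        · exact (opNorm_comp_le _ _).trans (by gcongr)
        · exact (opNorm_comp_le _ _).trans (by gcongr)
    _ = (2 * ‖V‖) * ε := by ring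
    _ ≤ (2 * (‖V‖ + 1)) * ε := by gcongr; linarith
    _ = 0 + δ := by rw [hε]; field_simp; ring

end Compression

/-! ### Block diagonal operators on a finite power of the space. -/

section Diagonal

open ContinuousLinearMap

variable {ι : Type*} [Fintype ι] {H : Type*} [NormedAddCommGroup H] [InnerProductSpace ℂ H]
  [CompleteSpace H]

/-- The operator `H → H^ι` with components `C i`. -/
noncomputable def columnOp (C : ι → H →L[ℂ] H) : H →L[ℂ] PiLp 2 (fun _ : ι => H) :=
  ((PiLp.continuousLinearEquiv 2 ℂ (fun _ : ι => H)).symm : (ι → H) →L[ℂ] _) ∘L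
    ContinuousLinearMap.pi C

omit [Fintype ι] [CompleteSpace H] in
@[simp] theorem columnOp_apply (C : ι → H →L[ℂ] H) (x : H) (i : ι) :
    columnOp C x i = C i x := rfl

variable (ι H) in
/-- The block diagonal operators on `H^ι`, as a homomorphism of star algebras. -/
noncomputable def diagonalOp : (ι → H →L[ℂ] H) →⋆ₐ[ℂ]
    (PiLp 2 (fun _ : ι => H) →L[ℂ] PiLp 2 (fun _ : ι => H)) where
  toFun X := ((PiLp.continuousLinearEquiv 2 ℂ (fun _ : ι => H)).symm : (ι → H) →L[ℂ] _) ∘L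
    ContinuousLinearMap.pi (fun i => X i ∘L PiLp.proj 2 (fun _ : ι => H) i)
  map_one' := by ext x i; simp
  map_mul' X Y := by ext x i; simp
  map_zero' := by ext x i; simp
  map_add' X Y := by ext x i; simp
  commutes' r := by ext x i; simp [Algebra.algebraMap_eq_smul_one]
  map_star' X := by
    refine (eq_adjoint_iff _ _).2 fun x y => ?_
    simp [PiLp.inner_apply, star_eq_adjoint, adjoint_inner_left]

@[simp] theorem diagonalOp_apply (X : ι → H →L[ℂ] H) (x : PiLp 2 (fun _ : ι => H)) (i : ι) :
    diagonalOp ι H X x i = X i (x i) := rfl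

/-- This turns a `C⋆`-convex combination into a single compression, reducing Jensen for sums to
Jensen for an isometry. -/
theorem adjoint_columnOp_comp (C : ι → H →L[ℂ] H) (X : ι → H →L[ℂ] H) :
    adjoint (columnOp C) ∘L diagonalOp ι H X ∘L columnOp C = ∑ i, star (C i) * X i * C i := by
  ext x
  refine ext_inner_right ℂ fun y => ?_
  simp [adjoint_inner_left, PiLp.inner_apply, sum_inner, star_eq_adjoint]

theorem spectrum_diagonalOp_subset {J : Set ℝ} {X : ι → H →L[ℂ] H}
    (hX : ∀ i, spectrum ℝ (X i) ⊆ J) : spectrum ℝ (diagonalOp ι H X) ⊆ J := by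
  refine (AlgHom.spectrum_apply_subset ((diagonalOp ι H).restrictScalars ℝ) X).trans ?_
  rw [Pi.spectrum_eq]
  exact Set.iUnion_subset hX

theorem isSelfAdjoint_diagonalOp {X : ι → H →L[ℂ] H} (hX : ∀ i, IsSelfAdjoint (X i)) :
    IsSelfAdjoint (diagonalOp ι H X) :=
  IsSelfAdjoint.map (x := X) (funext fun i => hX i) (diagonalOp ι H)

theorem cfc_diagonalOp {J : Set ℝ} (hJ : J.OrdConnected) {f : ℝ → ℝ} (hf : ContinuousOn f J)
    {X : ι → H →L[ℂ] H} (hX : ∀ i, IsSelfAdjoint (X i)) (hXJ : ∀ i, spectrum ℝ (X i) ⊆ J) :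
    cfc f (diagonalOp ι H X) = diagonalOp ι H (fun i => cfc f (X i)) := by
  classical
  -- The coordinate embeddings intertwine each block with the diagonal operator, and their ranges
  -- span, so the intertwining lemma determines the functional calculus.
  have hE : ∀ (Y : ι → H →L[ℂ] H) (i : ι),
      diagonalOp ι H Y ∘L columnOp (Pi.single i 1) = columnOp (Pi.single i 1) ∘L Y i := by
    intro Y i
    ext x j
    rcases eq_or_ne j i with rfl | hj
    · simp
    · simp [hj]
  have hx : ∀ x : PiLp 2 (fun _ : ι => H), x = ∑ i, columnOp (Pi.single i 1) (x i) := by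
    intro x
    ext j
    simp only [WithLp.ofLp_sum, Finset.sum_apply, columnOp_apply]
    rw [Finset.sum_eq_single j]
    · simp
    · intro b _ hb; simp [hb.symm]
    · simp
  have key : ∀ i, cfc f (diagonalOp ι H X) ∘L columnOp (Pi.single i 1)
      = diagonalOp ι H (fun i => cfc f (X i)) ∘L columnOp (Pi.single i 1) := by
    intro i
    rw [cfc_comp_of_comp_eq hJ hf (isSelfAdjoint_diagonalOp hX) (hX i)
      (spectrum_diagonalOp_subset hXJ) (hXJ i) (hE X i), hE]
  refine ContinuousLinearMap.ext fun x => ?_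
  rw [hx x, map_sum, map_sum]
  exact Finset.sum_congr rfl fun i _ => congrArg (fun T : H →L[ℂ] _ => T (x i)) (key i)

end Diagonal

/-! ### Jensen's operator inequality. -/

section Jensen

open ContinuousLinearMap

/-- Jensen's operator inequality for the compression by an isometry. -/
theorem OperatorConvexOn.cfc_adjoint_conj_le {J : Set ℝ} (hJ : J.OrdConnected) {f : ℝ → ℝ}
    (hf : OperatorConvexOn.{u} J f) {H L : Type u} [NormedAddCommGroup H] [InnerProductSpace ℂ H]
    [CompleteSpace H] [NormedAddCommGroup L] [InnerProductSpace ℂ L] [CompleteSpace L]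
    {X : L →L[ℂ] L} (hX : IsSelfAdjoint X) (hXJ : spectrum ℝ X ⊆ J) {V : H →L[ℂ] L}
    (hV : adjoint V ∘L V = 1) :
    cfc f (adjoint V ∘L X ∘L V) ≤ adjoint V ∘L cfc f X ∘L V := by
  have hVx : ∀ x, adjoint V (V x) = x := fun x => congrArg (fun T : H →L[ℂ] H => T x) hV
  -- `W` is the reflection fixing the range of `V`. Averaging `X` with `W X W` removes the
  -- off-diagonal blocks, so the average maps the range of `V` to itself and acts there as the
  -- compression of `X`; convexity at `1 / 2` then suffices.
  set W : L →L[ℂ] L := (2 : ℝ) • (V ∘L adjoint V) - 1 with hW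
  have hWx : ∀ x, W x = (2 : ℝ) • V (adjoint V x) - x := fun x => by simp [hW]
  have hWad : adjoint W = W := by
    have h1 : IsSelfAdjoint (V ∘L adjoint V) := by
      rw [isSelfAdjoint_iff, star_eq_adjoint, adjoint_comp, adjoint_adjoint]
    exact (((IsSelfAdjoint.all (2 : ℝ)).smul h1).sub (.one _)).adjoint_eq
  have hWV : ∀ x, W (V x) = V x := fun x => by rw [hWx, hVx, two_smul]; abel
  have hVW : ∀ x, adjoint V (W x) = adjoint V x := fun x => by
    rw [hWx, map_sub, ← Complex.coe_smul, map_smul, hVx, Complex.coe_smul, two_smul]; abel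
  have hWW : W * W = 1 := by
    ext x
    change W (W x) = x
    rw [hWx (W x), hVW, hWx]; abel
  have hconj : ∀ (T : L →L[ℂ] L) (x : L), (W * T * W) x = W (T (W x)) := fun _ _ => rfl
  set Y : L →L[ℂ] L := W * X * W with hY
  have hYsa : IsSelfAdjoint Y := by
    have := isSelfAdjoint_adjoint_conj hX W
    rwa [hWad] at this
  have hYJ : spectrum ℝ Y ⊆ J := by
    have := spectrum_adjoint_conj_subset hJ hX hXJ (V := W) (by rw [hWad]; exact hWW)
    rwa [hWad] at this
  have hfY : cfc f Y = W * cfc f X * W := by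
    have h1 : Y ∘L W = W ∘L X := by
      change W * X * W * W = W * X
      rw [mul_assoc, hWW, mul_one]
    have h2 : cfc f Y * W = W * cfc f X :=
      cfc_comp_of_comp_eq hJ hf.1 hYsa hX hYJ hXJ h1
    rw [← h2, mul_assoc, hWW, mul_one]
  set Z : L →L[ℂ] L := (1 / 2 : ℝ) • X + (1 - 1 / 2 : ℝ) • Y with hZ
  have hZsa : IsSelfAdjoint Z :=
    ((IsSelfAdjoint.all _).smul hX).add ((IsSelfAdjoint.all _).smul hYsa)
  have hconv := hf.2 L X Y hX hYsa hXJ hYJ (1 / 2) ⟨by norm_num, by norm_num⟩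
  rw [← hZ, hfY] at hconv
  have hC := isSelfAdjoint_adjoint_conj hX V
  have hCJ := spectrum_adjoint_conj_subset hJ hX hXJ hV
  have hZJ : spectrum ℝ Z ⊆ J :=
    spectrum_convexCombination_subset hJ hX hYsa hXJ hYJ (by norm_num) (by norm_num) (by norm_num)
  have hZV : Z ∘L V = V ∘L (adjoint V ∘L X ∘L V) := by
    ext x
    simp only [hZ, hY, comp_apply, add_apply, smul_apply, hconj, hWV, hWx]
    module
  have hfZ := cfc_comp_of_comp_eq hJ hf.1 hZsa hC hZJ hCJ hZV
  have hfC : cfc f (adjoint V ∘L X ∘L V) = adjoint V ∘L cfc f Z ∘L V := by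
    rw [hfZ]
    ext x
    simp [hVx]
  rw [hfC]
  refine (adjoint_conj_mono hconv V).trans_eq ?_
  ext x
  simp only [comp_apply, add_apply, smul_apply, hconj, hWV, map_add, ← Complex.coe_smul,
    map_smul, hVW]
  simp only [Complex.coe_smul]
  module

/-- Jensen's operator inequality for `C⋆`-convex combinations. -/
theorem OperatorConvexOn.cfc_sum_le_of_sum_eq_one {J : Set ℝ} (hJ : J.OrdConnected)
    {f : ℝ → ℝ} (hf : OperatorConvexOn.{u} J f) {ι : Type} [Fintype ι]
    {H : Type u} [NormedAddCommGroup H] [InnerProductSpace ℂ H] [CompleteSpace H]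
    {X C : ι → H →L[ℂ] H} (hX : ∀ i, IsSelfAdjoint (X i)) (hXJ : ∀ i, spectrum ℝ (X i) ⊆ J)
    (hC : ∑ i, star (C i) * C i = 1) :
    spectrum ℝ (∑ i, star (C i) * X i * C i) ⊆ J ∧
      cfc f (∑ i, star (C i) * X i * C i) ≤ ∑ i, star (C i) * cfc f (X i) * C i := by
  have hV : adjoint (columnOp C) ∘L columnOp C = 1 := by
    have h1 := adjoint_columnOp_comp C 1
    simp only [map_one, Pi.one_apply, mul_one] at h1
    exact h1.trans hC
  have hsa := isSelfAdjoint_diagonalOp hX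
  have hsp := spectrum_diagonalOp_subset hXJ
  have h1 := spectrum_adjoint_conj_subset hJ hsa hsp hV
  have h2 := hf.cfc_adjoint_conj_le hJ hsa hsp hV
  rw [cfc_diagonalOp hJ hf.1 hX hXJ] at h2
  rw [adjoint_columnOp_comp] at h1
  rw [adjoint_columnOp_comp, adjoint_columnOp_comp] at h2
  exact ⟨h1, h2⟩

/-- The Hansen–Pedersen form of Jensen's operator inequality. -/
theorem OperatorConvexOn.cfc_sum_le {J : Set ℝ} (hJ : J.OrdConnected) (h0 : (0 : ℝ) ∈ J)
    {f : ℝ → ℝ} (hf : OperatorConvexOn.{u} J f) (hf0 : f 0 ≤ 0) {ι : Type} [Fintype ι]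
    {H : Type u} [NormedAddCommGroup H] [InnerProductSpace ℂ H] [CompleteSpace H]
    {X C : ι → H →L[ℂ] H} (hX : ∀ i, IsSelfAdjoint (X i)) (hXJ : ∀ i, spectrum ℝ (X i) ⊆ J)
    (hC : ∑ i, star (C i) * C i ≤ 1) :
    spectrum ℝ (∑ i, star (C i) * X i * C i) ⊆ J ∧
      cfc f (∑ i, star (C i) * X i * C i) ≤ ∑ i, star (C i) * cfc f (X i) * C i := by
  -- The defect operator `D` completes the family to an exact `C⋆`-convex combination, paired with
  -- the operator `0`; its extra term is `D* f(0) D ≤ 0`.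
  obtain ⟨D, hD⟩ : ∃ D : H →L[ℂ] H, star D * D = 1 - ∑ i, star (C i) * C i := by
    refine ⟨CFC.sqrt (1 - ∑ i, star (C i) * C i), ?_⟩
    rw [(IsSelfAdjoint.of_nonneg (CFC.sqrt_nonneg _)).star_eq,
      CFC.sqrt_mul_sqrt_self _ (sub_nonneg.2 hC)]
  have h0J : spectrum ℝ (0 : H →L[ℂ] H) ⊆ J := by
    intro x hx
    by_cases hn : Nontrivial (H →L[ℂ] H)
    · rw [spectrum.zero_eq] at hx
      rwa [Set.mem_singleton_iff.1 hx]
    · rw [not_nontrivial_iff_subsingleton] at hn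
      rw [spectrum.of_subsingleton] at hx
      exact hx.elim
  have key := hf.cfc_sum_le_of_sum_eq_one hJ (ι := Option ι) (X := fun o => o.elim 0 X)
    (C := fun o => o.elim D C) (by rintro (_ | i); exacts [IsSelfAdjoint.zero _, hX i])
    (by rintro (_ | i); exacts [h0J, hXJ i])
    (by simp only [Fintype.sum_option, Option.elim, hD, sub_add_cancel])
  simp only [Fintype.sum_option, Option.elim, mul_zero, zero_mul, zero_add] at key
  refine ⟨key.1, key.2.trans (add_le_of_nonpos_left ?_)⟩
  have : cfc f (0 : H →L[ℂ] H) ≤ 0 := by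
    rw [cfc_apply_zero, ← map_zero (algebraMap ℝ (H →L[ℂ] H))]
    exact algebraMap_mono _ hf0
  simpa using star_left_conjugate_le_conjugate this D

end Jensen

/-! ### Joint convexity of the perspective. -/

section Perspective

variable {H : Type u} [NormedAddCommGroup H] [InnerProductSpace ℂ H] [CompleteSpace H]

theorem isStrictlyPositive_cfc {K : Set ℝ} {h : ℝ → ℝ} (hc : ContinuousOn h K)
    (hpos : ∀ x ∈ K, 0 < h x) {B : H →L[ℂ] H} (hB : IsSelfAdjoint B) (hBK : spectrum ℝ B ⊆ K) :
    IsStrictlyPositive (cfc h B) := by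
  rw [CStarAlgebra.isStrictlyPositive_iff_isSelfAdjoint_and_spectrum_pos]
  refine ⟨cfc_predicate h B, ?_⟩
  rw [cfc_map_spectrum h B hB (hc.mono hBK)]
  rintro _ ⟨x, hx, rfl⟩
  exact hpos x (hBK hx)

theorem OperatorConcaveOn.convexCombination_le {K : Set ℝ} {h : ℝ → ℝ}
    (hh : OperatorConcaveOn.{u} K h) {B₁ B₂ : H →L[ℂ] H} (h₁ : IsSelfAdjoint B₁)
    (h₂ : IsSelfAdjoint B₂) (h₁K : spectrum ℝ B₁ ⊆ K) (h₂K : spectrum ℝ B₂ ⊆ K) {s t : ℝ}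
    (hs : 0 ≤ s) (ht : 0 ≤ t) (hst : s + t = 1) :
    s • cfc h B₁ + t • cfc h B₂ ≤ cfc h (s • B₁ + t • B₂) := by
  obtain rfl : t = 1 - s := by linarith
  have := hh.2 H B₁ B₂ h₁ h₂ h₁K h₂K s ⟨hs, by linarith⟩
  simp only [cfc_neg, smul_neg, ← neg_add] at this
  exact neg_le_neg_iff.1 this

theorem OperatorConcaveOn.continuousOn {K : Set ℝ} {h : ℝ → ℝ}
    (hh : OperatorConcaveOn.{u} K h) : ContinuousOn h K := by
  exact hh.1.neg.congr fun x _ => (neg_neg _).symm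

section Weighted

open CFC

theorem rpow_half_mul_rpow_neg_half {S : H →L[ℂ] H} (hS : IsStrictlyPositive S) :
    S ^ (1 / 2 : ℝ) * S ^ (-(1 / 2) : ℝ) = 1 := rpow_mul_rpow_neg _ hS

theorem rpow_neg_half_mul_rpow_half {S : H →L[ℂ] H} (hS : IsStrictlyPositive S) :
    S ^ (-(1 / 2) : ℝ) * S ^ (1 / 2 : ℝ) = 1 := rpow_neg_mul_rpow _ hS

theorem rpow_half_mul_rpow_half {S : H →L[ℂ] H} (hS : IsStrictlyPositive S) :
    S ^ (1 / 2 : ℝ) * S ^ (1 / 2 : ℝ) = S := by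
  rw [← rpow_add hS.isUnit]
  norm_num
  exact rpow_one S hS.nonneg

theorem isSelfAdjoint_rpow (S : H →L[ℂ] H) (r : ℝ) : IsSelfAdjoint (S ^ r) :=
  .of_nonneg rpow_nonneg

/-- Jensen's operator inequality for the perspective of `f`, for a weighted sum. -/
theorem OperatorConvexOn.perspective_sum_le {J : Set ℝ} (hJ : J.OrdConnected)
    (h0 : (0 : ℝ) ∈ J) {f : ℝ → ℝ} (hf : OperatorConvexOn.{u} J f) (hf0 : f 0 ≤ 0) {ι : Type}
    [Fintype ι] {A S : ι → H →L[ℂ] H} {T : H →L[ℂ] H} {w : ι → ℝ} (hw : ∀ i, 0 ≤ w i)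
    (hA : ∀ i, IsSelfAdjoint (A i)) (hS : ∀ i, IsStrictlyPositive (S i))
    (hT : IsStrictlyPositive T) (hST : ∑ i, w i • S i ≤ T)
    (hJA : ∀ i, spectrum ℝ (S i ^ (-(1 / 2) : ℝ) * A i * S i ^ (-(1 / 2) : ℝ)) ⊆ J) :
    spectrum ℝ (T ^ (-(1 / 2) : ℝ) * (∑ i, w i • A i) * T ^ (-(1 / 2) : ℝ)) ⊆ J ∧
      T ^ (1 / 2 : ℝ) * cfc f (T ^ (-(1 / 2) : ℝ) * (∑ i, w i • A i) * T ^ (-(1 / 2) : ℝ)) *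
          T ^ (1 / 2 : ℝ) ≤
        ∑ i, w i • (S i ^ (1 / 2 : ℝ) *
          cfc f (S i ^ (-(1 / 2) : ℝ) * A i * S i ^ (-(1 / 2) : ℝ)) * S i ^ (1 / 2 : ℝ)) := by
  set m := T ^ (-(1 / 2) : ℝ) with hm
  set q := T ^ (1 / 2 : ℝ) with hq
  have hms : star m = m := isSelfAdjoint_rpow T _
  have hqs : star q = q := isSelfAdjoint_rpow T _
  have hmq : m * q = 1 := rpow_neg_half_mul_rpow_half hT
  have hqm : q * m = 1 := rpow_half_mul_rpow_neg_half hT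
  set X : ι → H →L[ℂ] H := fun i => S i ^ (-(1 / 2) : ℝ) * A i * S i ^ (-(1 / 2) : ℝ) with hX
  -- With this choice `C_i* X_i C_i = w_i T^{-1/2} A_i T^{-1/2}` and `∑ C_i* C_i = T^{-1/2} (∑ w_i
  -- S_i) T^{-1/2} ≤ 1`.
  set C : ι → H →L[ℂ] H := fun i => √(w i) • (S i ^ (1 / 2 : ℝ) * m) with hC
  have hXs : ∀ i, IsSelfAdjoint (X i) := fun i => by
    have := (hA i).conjugate (S i ^ (-(1 / 2) : ℝ))
    rwa [(isSelfAdjoint_rpow (S i) _).star_eq] at this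
  have hconj : ∀ i (Y : H →L[ℂ] H), star (C i) * Y * C i
      = w i • (m * (S i ^ (1 / 2 : ℝ) * Y * S i ^ (1 / 2 : ℝ)) * m) := by
    intro i Y
    simp only [hC, star_smul, star_mul, hms, (isSelfAdjoint_rpow (S i) _).star_eq, star_trivial,
      smul_mul_assoc, mul_smul_comm, smul_smul, Real.mul_self_sqrt (hw i), mul_assoc]
  have hSX : ∀ i, S i ^ (1 / 2 : ℝ) * X i * S i ^ (1 / 2 : ℝ) = A i := by
    intro i
    simp only [hX, mul_assoc, rpow_neg_half_mul_rpow_half (hS i), mul_one]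
    rw [← mul_assoc, rpow_half_mul_rpow_neg_half (hS i), one_mul]
  have hsum : ∑ i, star (C i) * X i * C i = m * (∑ i, w i • A i) * m := by
    simp only [hconj, hSX, Finset.mul_sum, Finset.sum_mul, mul_smul_comm, smul_mul_assoc]
  have hmTm : m * T * m = 1 := CFC.conjugate_rpow_neg_one_half T hT
  have hC1 : ∑ i, star (C i) * C i ≤ 1 := by
    have : ∑ i, star (C i) * C i = m * (∑ i, w i • S i) * m := by
      simp only [Finset.mul_sum, Finset.sum_mul, mul_smul_comm, smul_mul_assoc]
      refine Finset.sum_congr rfl fun i _ => ?_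
      have := hconj i 1
      rwa [mul_one, mul_one, rpow_half_mul_rpow_half (hS i)] at this
    rw [this, ← hmTm]
    have := star_left_conjugate_le_conjugate hST m
    rwa [hms] at this
  obtain ⟨h1, h2⟩ := hf.cfc_sum_le hJ h0 hf0 hXs hJA hC1
  rw [hsum] at h1 h2
  refine ⟨h1, ?_⟩
  have h3 := star_left_conjugate_le_conjugate h2 q
  rw [hqs] at h3
  refine h3.trans_eq ?_
  simp only [hconj, Finset.mul_sum, Finset.sum_mul, mul_smul_comm, smul_mul_assoc]
  refine Finset.sum_congr rfl fun i _ => ?_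
  congr 1
  calc q * (m * (S i ^ (1 / 2 : ℝ) * cfc f (X i) * S i ^ (1 / 2 : ℝ)) * m) * q
      = (q * m) * (S i ^ (1 / 2 : ℝ) * cfc f (X i) * S i ^ (1 / 2 : ℝ)) * (m * q) := by
        simp only [mul_assoc]
    _ = _ := by rw [hqm, hmq, one_mul, mul_one]

end Weighted

/-- The pairs of self-adjoint operators for which the perspective `f Δ h` is defined. -/
def perspectiveDomain (J K : Set ℝ) (h : ℝ → ℝ) : Set ((H →L[ℂ] H) × (H →L[ℂ] H)) :=
  {p | IsSelfAdjoint p.1 ∧ IsSelfAdjoint p.2 ∧ spectrum ℝ p.2 ⊆ K ∧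
    spectrum ℝ (opQuotient h p.1 p.2) ⊆ J}

/-- The generalized perspective of an operator convex and an operator concave function is jointly
convex. -/
theorem perspectiveDelta_convexOn {J K : Set ℝ} (hJ : J.OrdConnected) (hK : K.OrdConnected)
    (h0 : (0 : ℝ) ∈ J) {f h : ℝ → ℝ} (hf : OperatorConvexOn.{u} J f) (hf0 : f 0 ≤ 0)
    (hh : OperatorConcaveOn.{u} K h) (hpos : ∀ x ∈ K, 0 < h x) :
    ConvexOn ℝ (perspectiveDomain (H := H) J K h) (fun p => perspectiveDelta f h p.1 p.2) := by
  have key : ∀ p ∈ perspectiveDomain (H := H) J K h, ∀ q ∈ perspectiveDomain (H := H) J K h,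
      ∀ s t : ℝ, 0 ≤ s → 0 ≤ t → s + t = 1 → s • p + t • q ∈ perspectiveDomain (H := H) J K h ∧
        perspectiveDelta f h (s • p + t • q).1 (s • p + t • q).2 ≤
          s • perspectiveDelta f h p.1 p.2 + t • perspectiveDelta f h q.1 q.2 := by
    rintro ⟨A₁, B₁⟩ ⟨hA₁, hB₁, hBK₁, hAJ₁⟩ ⟨A₂, B₂⟩ ⟨hA₂, hB₂, hBK₂, hAJ₂⟩ s t hs ht hst
    simp only at hA₁ hB₁ hBK₁ hAJ₁ hA₂ hB₂ hBK₂ hAJ₂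
    have hB : IsSelfAdjoint (s • B₁ + t • B₂) :=
      ((IsSelfAdjoint.all _).smul hB₁).add ((IsSelfAdjoint.all _).smul hB₂)
    have hBK := spectrum_convexCombination_subset hK hB₁ hB₂ hBK₁ hBK₂ hs ht hst
    have main := hf.perspective_sum_le hJ h0 hf0 (ι := Fin 2) (A := ![A₁, A₂])
      (S := ![cfc h B₁, cfc h B₂]) (T := cfc h (s • B₁ + t • B₂)) (w := ![s, t])
      (by simp [Fin.forall_fin_two, hs, ht]) (by simp [Fin.forall_fin_two, hA₁, hA₂])
      (by
        rw [Fin.forall_fin_two]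
        exact ⟨isStrictlyPositive_cfc hh.continuousOn hpos hB₁ hBK₁,
          isStrictlyPositive_cfc hh.continuousOn hpos hB₂ hBK₂⟩)
      (isStrictlyPositive_cfc hh.continuousOn hpos hB hBK)
      (by
        simpa [Fin.sum_univ_two] using
          hh.convexCombination_le hB₁ hB₂ hBK₁ hBK₂ hs ht hst)
      (by rw [Fin.forall_fin_two]; exact ⟨hAJ₁, hAJ₂⟩)
    simp only [Fin.sum_univ_two, Matrix.cons_val_zero, Matrix.cons_val_one] at main
    exact ⟨⟨((IsSelfAdjoint.all _).smul hA₁).add ((IsSelfAdjoint.all _).smul hA₂), hB, hBK,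
      main.1⟩, main.2⟩
  exact ⟨fun p hp q hq s t hs ht hst => (key p hp q hq s t hs ht hst).1,
    fun p hp q hq s t hs ht hst => (key p hp q hq s t hs ht hst).2⟩

end Perspective

/-! ### Norm continuity of the functional calculus on an interval. -/

section Continuity

open Topology Filter

theorem Set.OrdConnected.isLocallyClosed_real {J : Set ℝ} (hJ : J.OrdConnected) :
    IsLocallyClosed J := by
  have := hJ.isPreconnected.mem_intervals
  simp only [Set.mem_insert_iff, Set.mem_singleton_iff] at this
  rcases this with h | h | h | h | h | h | h | h | h | h <;> rw [h]
  · exact isLocallyClosed_Icc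
  · exact isLocallyClosed_Ico
  · exact isLocallyClosed_Ioc
  · exact isLocallyClosed_Ioo
  · exact isLocallyClosed_Ici
  · exact isLocallyClosed_Ioi
  · exact isLocallyClosed_Iic
  · exact isLocallyClosed_Iio
  · exact isOpen_univ.isLocallyClosed
  · exact isOpen_empty.isLocallyClosed

variable {H : Type*} [NormedAddCommGroup H] [InnerProductSpace ℂ H] [CompleteSpace H]

/-- The functional calculus of a function that is continuous on an interval is norm continuous on
the self-adjoint operators with spectrum in that interval. -/
theorem continuousOn_cfc_of_ordConnected {J : Set ℝ} (hJ : J.OrdConnected) {f : ℝ → ℝ}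
    (hf : ContinuousOn f J) :
    ContinuousOn (cfc f : (H →L[ℂ] H) → (H →L[ℂ] H))
      {a | IsSelfAdjoint a ∧ spectrum ℝ a ⊆ J} := by
  intro a₀ ha₀
  -- Local compactness of `J` gives a compact `S`, a neighbourhood of the spectrum relative to `J`.
  -- By upper hemicontinuity it also contains the spectra of nearby operators whose spectra lie in
  -- `J`.
  have : LocallyCompactSpace J := hJ.isLocallyClosed_real.locallyCompactSpace
  have hcomp : IsCompact ((↑) ⁻¹' spectrum ℝ a₀ : Set J) :=
    IsInducing.subtypeVal.isCompact_preimage_iff (by simpa using ha₀.2) |>.2 (spectrum.isCompact a₀)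
  obtain ⟨S, hS, hsub⟩ := exists_compact_superset hcomp
  obtain ⟨U, hU, hUS⟩ := isOpen_induced_iff.1 (isOpen_interior (s := S))
  have hUJ : ∀ x ∈ U, x ∈ J → x ∈ ((↑) '' S : Set ℝ) := fun x hx hxJ =>
    ⟨⟨x, hxJ⟩, interior_subset (hUS ▸ (show (⟨x, hxJ⟩ : J) ∈ Subtype.val ⁻¹' U from hx)), rfl⟩
  have hspecU : spectrum ℝ a₀ ⊆ U := fun x hx => by
    have : (⟨x, ha₀.2 hx⟩ : J) ∈ interior S := hsub hx
    rw [← hUS] at this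
    exact this
  have hev : ∀ᶠ a in 𝓝 a₀, spectrum ℝ a ⊆ U := by
    have := upperHemicontinuousAt_iff.1
      (upperHemicontinuous_iff.1 (upperHemicontinuous_spectrum ℝ (H →L[ℂ] H)) a₀) U
      (hU.mem_nhdsSet.2 hspecU)
    exact this.mono fun _ => subset_of_mem_nhdsSet
  have hSJ : ((↑) '' S : Set ℝ) ⊆ J := by rintro _ ⟨x, -, rfl⟩; exact x.2
  refine Filter.Tendsto.cfc (hS.image continuous_subtype_val) f
    (tendsto_id.mono_left nhdsWithin_le_nhds) ?_ ?_ ?_ ha₀.1 (hf.mono hSJ)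
  · filter_upwards [nhdsWithin_le_nhds hev, self_mem_nhdsWithin] with a ha haJ x hx
    exact hUJ x (ha hx) (haJ.2 hx)
  · filter_upwards [self_mem_nhdsWithin] with a ha using ha.1
  · exact fun x hx => hUJ x (hspecU hx) (ha₀.2 hx)

end Continuity

/-! ### Norm continuity of the perspective. -/

section Perspective

variable {H : Type u} [NormedAddCommGroup H] [InnerProductSpace ℂ H] [CompleteSpace H]

theorem continuousOn_perspectiveDelta {J K : Set ℝ} (hJ : J.OrdConnected) (hK : K.OrdConnected)
    {f h : ℝ → ℝ} (hf : ContinuousOn f J) (hc : ContinuousOn h K) (hpos : ∀ x ∈ K, 0 < h x) :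
    ContinuousOn (fun p : (H →L[ℂ] H) × (H →L[ℂ] H) => perspectiveDelta f h p.1 p.2)
      (perspectiveDomain J K h) := by
  have hr : ∀ r : ℝ, ContinuousOn (fun p : (H →L[ℂ] H) × (H →L[ℂ] H) => cfc h p.2 ^ r)
      (perspectiveDomain J K h) := by
    intro r
    have h1 : ContinuousOn (fun x => h x ^ r) K := hc.rpow_const fun x hx => Or.inl (hpos x hx).ne'
    have h2 := (continuousOn_cfc_of_ordConnected (H := H) hK h1).comp
      (continuousOn_snd (s := perspectiveDomain J K h)) fun p hp => ⟨hp.2.1, hp.2.2.1⟩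
    exact h2.congr fun p hp =>
      CFC.cfc_rpow (fun x hx => hpos x (hp.2.2.1 hx)) (hc.mono hp.2.2.1) hp.2.1
  have hq : ContinuousOn (fun p : (H →L[ℂ] H) × (H →L[ℂ] H) => opQuotient h p.1 p.2)
      (perspectiveDomain J K h) := ((hr _).mul continuousOn_fst).mul (hr _)
  have hfq := (continuousOn_cfc_of_ordConnected (H := H) hJ hf).comp hq fun p hp => by
    refine ⟨?_, hp.2.2.2⟩
    have := hp.1.conjugate (cfc h p.2 ^ (-(1 / 2) : ℝ))
    rwa [(isSelfAdjoint_rpow _ _).star_eq] at this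
  exact ((hr _).mul hfq).mul (hr _)

end Perspective

/-! ### Margins and integrals of operator fields. -/

section Integral

variable {H : Type*} [NormedAddCommGroup H] [InnerProductSpace ℂ H] [CompleteSpace H]

theorem IsStrictlyPositive.exists_algebraMap_le {S : H →L[ℂ] H} (hS : IsStrictlyPositive S) :
    ∃ r > 0, algebraMap ℝ (H →L[ℂ] H) r ≤ S := by
  rcases subsingleton_or_nontrivial (H →L[ℂ] H) with hs | hn
  · exact ⟨1, one_pos, (Subsingleton.elim _ _).le⟩
  · exact (CFC.exists_pos_algebraMap_le_iff hS.isSelfAdjoint).2 fun x hx => hS.spectrum_pos hx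

/-- A strict upper bound for `S^{-1/2} A S^{-1/2}` in terms of `A` and `S`. -/
theorem exists_rpow_conj_le_algebraMap_iff {S A : H →L[ℂ] H} (hS : IsStrictlyPositive S) (x : ℝ) :
    (∃ ε > 0, S ^ (-(1 / 2) : ℝ) * A * S ^ (-(1 / 2) : ℝ) ≤ algebraMap ℝ _ (x - ε)) ↔
      ∃ δ > 0, algebraMap ℝ _ δ ≤ x • S - A := by
  have hm := isSelfAdjoint_rpow S (-(1 / 2))
  have hq := isSelfAdjoint_rpow S (1 / 2)
  have hle : ∀ r : ℝ, S ^ (-(1 / 2) : ℝ) * A * S ^ (-(1 / 2) : ℝ) ≤ algebraMap ℝ _ r ↔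
      A ≤ r • S := by
    intro r
    constructor
    · intro h
      have h1 := hq.conjugate_le_conjugate h
      have e1 : S ^ (1 / 2 : ℝ) * (S ^ (-(1 / 2) : ℝ) * A * S ^ (-(1 / 2) : ℝ)) *
          S ^ (1 / 2 : ℝ) = A := by
        simp only [mul_assoc, rpow_neg_half_mul_rpow_half hS, mul_one]
        rw [← mul_assoc, rpow_half_mul_rpow_neg_half hS, one_mul]
      rwa [e1, Algebra.algebraMap_eq_smul_one, mul_smul_comm, mul_one, smul_mul_assoc,
        rpow_half_mul_rpow_half hS] at h1
    · intro h
      have h1 := hm.conjugate_le_conjugate h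
      rwa [mul_smul_comm, smul_mul_assoc, CFC.conjugate_rpow_neg_one_half S hS,
        ← Algebra.algebraMap_eq_smul_one] at h1
  simp only [hle]
  constructor
  · rintro ⟨ε, hε, h⟩
    obtain ⟨s, hs, hsS⟩ := hS.exists_algebraMap_le
    -- Here `s ≤ S`, so `ε * s ≤ ε • S`; conversely `S ≤ ‖S‖ + 1` dictates the quotient `δ / (‖S‖ +
    -- 1)` below.
    refine ⟨ε * s, mul_pos hε hs, ?_⟩
    have h1 : ε • algebraMap ℝ (H →L[ℂ] H) s ≤ ε • S := smul_le_smul_of_nonneg_left hsS hε.le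
    rw [sub_smul] at h
    rw [map_mul, ← Algebra.smul_def]
    exact h1.trans (by rw [le_sub_comm]; exact h)
  · rintro ⟨δ, hδ, h⟩
    have hM : 0 < ‖S‖ + 1 := by positivity
    refine ⟨δ / (‖S‖ + 1), div_pos hδ hM, ?_⟩
    have h1 : S ≤ algebraMap ℝ _ (‖S‖ + 1) :=
      hS.isSelfAdjoint.le_algebraMap_norm_self.trans (algebraMap_mono _ (by linarith))
    have h2 := smul_le_smul_of_nonneg_left h1 (div_pos hδ hM).le
    rw [Algebra.smul_def (δ / (‖S‖ + 1)) (algebraMap ℝ (H →L[ℂ] H) (‖S‖ + 1)), ← map_mul, div_mul_cancel₀ _ hM.ne'] at h2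
    rw [sub_smul, le_sub_comm]
    exact h2.trans h

variable {T : Type*} [MeasurableSpace T] {μ : Measure T}

theorem isSelfAdjoint_integral [IsProbabilityMeasure μ] {B : T → H →L[ℂ] H}
    (hB : ∀ t, IsSelfAdjoint (B t)) (hi : Integrable B μ) : IsSelfAdjoint (∫ t, B t ∂μ) := by
  have hconv : Convex ℝ {a : H →L[ℂ] H | IsSelfAdjoint a} := fun a ha b hb s t _ _ _ =>
    ((IsSelfAdjoint.all s).smul ha).add ((IsSelfAdjoint.all t).smul hb)
  exact hconv.integral_mem (isClosed_eq continuous_star continuous_id) (.of_forall hB) hi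

theorem integral_algebraMap (e : T → ℝ) :
    ∫ t, algebraMap ℝ (H →L[ℂ] H) (e t) ∂μ = algebraMap ℝ (H →L[ℂ] H) (∫ t, e t ∂μ) := by
  simp only [Algebra.algebraMap_eq_smul_one]
  exact integral_smul_const e 1

omit [CompleteSpace H] in
theorem Integrable.algebraMap_continuousLinearMap {e : T → ℝ} (he : Integrable e μ) :
    Integrable (fun t => algebraMap ℝ (H →L[ℂ] H) (e t)) μ := by
  simp only [Algebra.algebraMap_eq_smul_one]
  exact he.smul_const 1

variable [TopologicalSpace T] [BorelSpace T]

/-- A continuous field of strictly positive operators dominates a scalar field with positive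
integral. -/
theorem exists_integrable_algebraMap_le [IsProbabilityMeasure μ] {G : T → H →L[ℂ] H}
    (hG : Continuous G) (hpos : ∀ t, ∃ ε > 0, algebraMap ℝ (H →L[ℂ] H) ε ≤ G t) :
    ∃ e : T → ℝ, Integrable e μ ∧ 0 < ∫ t, e t ∂μ ∧ ∀ t, algebraMap ℝ (H →L[ℂ] H) (e t) ≤ G t := by
  -- The pointwise margins need not be measurable in `t`, but these sets are closed and cover `T`,
  -- so one has positive measure; a multiple of its indicator is the scalar field.
  set S : ℕ → Set T := fun n => {t | algebraMap ℝ (H →L[ℂ] H) (1 / ((n : ℝ) + 1)) ≤ G t} with hS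
  have hSm : ∀ n, MeasurableSet (S n) := fun n => (isClosed_le continuous_const hG).measurableSet
  have hSU : ⋃ n, S n = Set.univ := by
    refine Set.eq_univ_of_forall fun t => ?_
    obtain ⟨ε, hε, h⟩ := hpos t
    obtain ⟨n, hn⟩ := exists_nat_one_div_lt hε
    exact Set.mem_iUnion.2 ⟨n, (algebraMap_mono _ hn.le).trans h⟩
  obtain ⟨n, hn⟩ : ∃ n, μ (S n) ≠ 0 := by
    by_contra! h
    have := measure_iUnion_null h
    rw [hSU, measure_univ] at this
    exact one_ne_zero this
  have hn1 : (0 : ℝ) < 1 / ((n : ℝ) + 1) := by positivity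
  refine ⟨(S n).indicator fun _ => 1 / ((n : ℝ) + 1), (integrable_const _).indicator (hSm n), ?_,
    fun t => ?_⟩
  · rw [integral_indicator_const _ (hSm n), smul_eq_mul]
    exact mul_pos (ENNReal.toReal_pos hn (measure_ne_top _ _)) hn1
  · by_cases ht : t ∈ S n
    · rw [Set.indicator_of_mem ht]; exact ht
    · rw [Set.indicator_of_notMem ht]
      obtain ⟨ε, hε, h⟩ := hpos t
      exact (algebraMap_mono _ hε.le).trans h

theorem exists_algebraMap_le_integral [IsProbabilityMeasure μ] {G : T → H →L[ℂ] H}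
    (hG : Continuous G) (hi : Integrable G μ)
    (hpos : ∀ t, ∃ ε > 0, algebraMap ℝ (H →L[ℂ] H) ε ≤ G t) :
    ∃ ε > 0, algebraMap ℝ (H →L[ℂ] H) ε ≤ ∫ t, G t ∂μ := by
  obtain ⟨e, he, hpos, hle⟩ := exists_integrable_algebraMap_le (μ := μ) hG hpos
  refine ⟨_, hpos, ?_⟩
  rw [← integral_algebraMap]
  exact integral_mono (Integrable.algebraMap_continuousLinearMap he) hi hle

theorem spectrum_integral_subset [IsProbabilityMeasure μ] {K : Set ℝ} (hK : K.OrdConnected)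
    {B : T → H →L[ℂ] H} (hc : Continuous B) (hB : ∀ t, IsSelfAdjoint (B t))
    (hBK : ∀ t, spectrum ℝ (B t) ⊆ K) (hi : Integrable B μ) :
    spectrum ℝ (∫ t, B t ∂μ) ⊆ K := by
  have hBK' := fun t => ((hB t).spectrum_subset_iff hK).1 (hBK t)
  rw [(isSelfAdjoint_integral hB hi).spectrum_subset_iff hK]
  refine ⟨fun x hx => ?_, fun x hx => ?_⟩
  · obtain ⟨ε, hε, h⟩ := exists_algebraMap_le_integral (μ := μ)
      (G := fun t => algebraMap ℝ (H →L[ℂ] H) x - B t) (continuous_const.sub hc)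
      ((integrable_const _).sub hi) fun t => by
        obtain ⟨ε, hε, h⟩ := (hBK' t).1 x hx
        exact ⟨ε, hε, by rwa [le_sub_comm, ← map_sub]⟩
    refine ⟨ε, hε, ?_⟩
    rw [integral_sub (integrable_const _) hi, integral_const, probReal_univ, one_smul,
      le_sub_comm, ← map_sub] at h
    exact h
  · obtain ⟨ε, hε, h⟩ := exists_algebraMap_le_integral (μ := μ)
      (G := fun t => B t - algebraMap ℝ (H →L[ℂ] H) x) (hc.sub continuous_const)
      (hi.sub (integrable_const _)) fun t => by
        obtain ⟨ε, hε, h⟩ := (hBK' t).2 x hx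
        exact ⟨ε, hε, by rwa [le_sub_iff_add_le, ← map_add, add_comm]⟩
    refine ⟨ε, hε, ?_⟩
    rw [integral_sub hi (integrable_const _), integral_const, probReal_univ, one_smul,
      le_sub_iff_add_le, ← map_add, add_comm] at h
    exact h

end Integral

/-! ### The integrated pair lies in the domain. -/

section Perspective

variable {H : Type u} [NormedAddCommGroup H] [InnerProductSpace ℂ H] [CompleteSpace H]
  {T : Type*} [MeasurableSpace T] {μ : Measure T} [TopologicalSpace T] [BorelSpace T]

/-- Since `x ≥ 0`, the expression `x h(B) - A - r` is concave in `(A, B, r)`, so its nonnegativity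
set is convex. Carrying the margin as the coordinate `r` preserves strictness under integration. The
integral lies only in the closure of that set; continuity at the limit, where the spectrum of `∫ B`
is already in `K`, recovers the inequality. -/
theorem OperatorConcaveOn.exists_algebraMap_le_integral [IsProbabilityMeasure μ] {K : Set ℝ}
    (hK : K.OrdConnected) {h : ℝ → ℝ} (hh : OperatorConcaveOn.{u} K h) {x : ℝ} (hx : 0 ≤ x)
    {A B : T → H →L[ℂ] H} (hAc : Continuous A) (hBc : Continuous B)
    (hB : ∀ t, IsSelfAdjoint (B t)) (hBK : ∀ t, spectrum ℝ (B t) ⊆ K) (hAi : Integrable A μ)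
    (hBi : Integrable B μ)
    (hpos : ∀ t, ∃ ε > 0, algebraMap ℝ (H →L[ℂ] H) ε ≤ x • cfc h (B t) - A t) :
    ∃ ε > 0, algebraMap ℝ (H →L[ℂ] H) ε ≤ x • cfc h (∫ t, B t ∂μ) - ∫ t, A t ∂μ := by
  have hcfc := continuousOn_cfc_of_ordConnected (H := H) hK hh.continuousOn
  have hhB : Continuous fun t => cfc h (B t) :=
    hcfc.comp_continuous hBc fun t => ⟨hB t, hBK t⟩
  obtain ⟨e, hei, hepos, he⟩ := exists_integrable_algebraMap_le (μ := μ)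
    ((hhB.const_smul x).sub hAc) hpos
  refine ⟨_, hepos, ?_⟩
  set F : (H →L[ℂ] H) × (H →L[ℂ] H) × ℝ → H →L[ℂ] H := fun p =>
    x • cfc h p.2.1 - p.1 - algebraMap ℝ (H →L[ℂ] H) p.2.2 with hF
  set E : Set ((H →L[ℂ] H) × (H →L[ℂ] H) × ℝ) :=
    {p | (IsSelfAdjoint p.2.1 ∧ spectrum ℝ p.2.1 ⊆ K) ∧ 0 ≤ F p} with hE
  have hconv : Convex ℝ E := by
    rintro ⟨A₁, B₁, r₁⟩ ⟨⟨h₁, h₁K⟩, h₁F⟩ ⟨A₂, B₂, r₂⟩ ⟨⟨h₂, h₂K⟩, h₂F⟩ s t hs ht hst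
    simp only [hF] at h₁ h₁K h₁F h₂ h₂K h₂F
    refine ⟨⟨((IsSelfAdjoint.all s).smul h₁).add ((IsSelfAdjoint.all t).smul h₂),
      spectrum_convexCombination_subset hK h₁ h₂ h₁K h₂K hs ht hst⟩, ?_⟩
    have hc := smul_le_smul_of_nonneg_left
      (hh.convexCombination_le h₁ h₂ h₁K h₂K hs ht hst) hx
    have hp := add_nonneg (smul_nonneg hs h₁F) (smul_nonneg ht h₂F)
    have hp2 := add_nonneg hp (sub_nonneg.2 hc)
    refine hp2.trans_eq ?_
    simp only [hF, Prod.smul_mk, Prod.mk_add_mk, Algebra.algebraMap_eq_smul_one]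
    module
  have hmem : (∫ t, A t ∂μ, ∫ t, B t ∂μ, ∫ t, e t ∂μ) ∈ closure E := by
    have := hconv.closure.integral_mem (μ := μ) isClosed_closure
      (f := fun t => (A t, B t, e t)) (.of_forall fun t => subset_closure
        ⟨⟨hB t, hBK t⟩, sub_nonneg.2 (he t)⟩) (hAi.prodMk (hBi.prodMk hei))
    rwa [integral_pair hAi (hBi.prodMk hei), integral_pair hBi hei] at this
  have hcont : ContinuousOn F {p | IsSelfAdjoint p.2.1 ∧ spectrum ℝ p.2.1 ⊆ K} := by
    have h1 : ContinuousOn (fun p : (H →L[ℂ] H) × (H →L[ℂ] H) × ℝ => cfc h p.2.1)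
        {p | IsSelfAdjoint p.2.1 ∧ spectrum ℝ p.2.1 ⊆ K} :=
      hcfc.comp (by fun_prop) fun p hp => hp
    exact ((h1.const_smul x).sub continuousOn_fst).sub
      ((algebraMapCLM ℝ (H →L[ℂ] H)).continuous.comp (by fun_prop)).continuousOn
  have hwithin := (hcont _ (show (∫ t, A t ∂μ, ∫ t, B t ∂μ, ∫ t, e t ∂μ) ∈ _ from
    ⟨isSelfAdjoint_integral hB hBi, spectrum_integral_subset hK hBc hB hBK hBi⟩)).mono
      (show E ⊆ _ from fun p hp => hp.1)
  have := hwithin.mem_closure hmem (t := Set.Ici 0) fun p hp => hp.2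
  rw [closure_Ici] at this
  exact sub_nonneg.1 this

theorem spectrum_opQuotient_integral_subset [IsProbabilityMeasure μ] {J K : Set ℝ}
    (hJ : J.OrdConnected) (hK : K.OrdConnected) (h0 : (0 : ℝ) ∈ J) {h : ℝ → ℝ}
    (hh : OperatorConcaveOn.{u} K h) (hpos : ∀ x ∈ K, 0 < h x)
    {A B : T → H →L[ℂ] H} (hAc : Continuous A) (hBc : Continuous B)
    (hA : ∀ t, IsSelfAdjoint (A t)) (hB : ∀ t, IsSelfAdjoint (B t))
    (hBK : ∀ t, spectrum ℝ (B t) ⊆ K) (hAJ : ∀ t, spectrum ℝ (opQuotient h (A t) (B t)) ⊆ J)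
    (hAi : Integrable A μ) (hBi : Integrable B μ) :
    spectrum ℝ (opQuotient h (∫ t, A t ∂μ) (∫ t, B t ∂μ)) ⊆ J := by
  have hsa : ∀ {A B : H →L[ℂ] H}, IsSelfAdjoint A → IsSelfAdjoint (opQuotient h A B) := by
    intro A B hA
    have := hA.conjugate (cfc h B ^ (-(1 / 2) : ℝ))
    rwa [(isSelfAdjoint_rpow _ _).star_eq] at this
  have hneg : ∀ A B : H →L[ℂ] H, opQuotient h (-A) B = -opQuotient h A B := by
    intro A B; simp [opQuotient]
  have hflip : ∀ (Q : H →L[ℂ] H) (x ε : ℝ), algebraMap ℝ (H →L[ℂ] H) (x + ε) ≤ Q ↔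
      -Q ≤ algebraMap ℝ (H →L[ℂ] H) (-x - ε) := by
    intro Q x ε
    rw [show -x - ε = -(x + ε) by ring, map_neg, neg_le_neg_iff]
  have hS : ∀ t, IsStrictlyPositive (cfc h (B t)) := fun t =>
    isStrictlyPositive_cfc hh.continuousOn hpos (hB t) (hBK t)
  have hSI : IsStrictlyPositive (cfc h (∫ t, B t ∂μ)) :=
    isStrictlyPositive_cfc hh.continuousOn hpos (isSelfAdjoint_integral hB hBi)
      (spectrum_integral_subset hK hBc hB hBK hBi)
  have hAJ' := fun t => ((hsa (hA t)).spectrum_subset_iff hJ).1 (hAJ t)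
  rw [(hsa (isSelfAdjoint_integral hA hAi)).spectrum_subset_iff hJ]
  refine ⟨fun x hx => ?_, fun x hx => ?_⟩
  -- As `0 ∈ J`, strict upper bounds of `J` are positive and strict lower bounds negative; the
  -- latter are treated through `-A` and `-x`, again with a nonnegative factor.
  · exact (exists_rpow_conj_le_algebraMap_iff hSI x).2
      (hh.exists_algebraMap_le_integral hK (hx 0 h0).le hAc hBc hB hBK hAi hBi fun t =>
        (exists_rpow_conj_le_algebraMap_iff (hS t) x).1 ((hAJ' t).1 x hx))
  · have key := (exists_rpow_conj_le_algebraMap_iff hSI (-x)).2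
      (hh.exists_algebraMap_le_integral hK (neg_pos.2 (hx 0 h0)).le hAc.neg hBc hB hBK
        hAi.neg hBi fun t => (exists_rpow_conj_le_algebraMap_iff (hS t) (-x)).1 (by
          obtain ⟨ε, hε, hle⟩ := (hAJ' t).2 x hx
          rw [hflip, ← hneg] at hle
          exact ⟨ε, hε, hle⟩))
    obtain ⟨ε, hε, hle⟩ := key
    refine ⟨ε, hε, ?_⟩
    rw [hflip, ← hneg]
    simp only [Pi.neg_apply, integral_neg] at hle
    exact hle

end Perspective

theorem theorem2p9 {H : Type u} [NormedAddCommGroup H] [InnerProductSpace ℂ H] [CompleteSpace H]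
    {T : Type*} [TopologicalSpace T] [T2Space T] [LocallyCompactSpace T]
    [MeasurableSpace T] [BorelSpace T]
    (μ : Measure T) [μ.Regular] [IsProbabilityMeasure μ]
    (J K : Set ℝ) (hJ : J.OrdConnected) (hK : K.OrdConnected) (h0J : (0 : ℝ) ∈ J)
    (f h : ℝ → ℝ)
    (hf : OperatorConvexOn.{u} J f) (hf0 : f 0 ≤ 0)
    (hh : OperatorConcaveOn.{u} K h) (hpos : ∀ x ∈ K, 0 < h x)
    (A B : T → H →L[ℂ] H) (hAc : Continuous A) (hBc : Continuous B)
    (hAsa : ∀ t, IsSelfAdjoint (A t)) (hBsa : ∀ t, IsSelfAdjoint (B t))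
    (hBK : ∀ t, spectrum ℝ (B t) ⊆ K)
    (hAJ : ∀ t, spectrum ℝ (opQuotient h (A t) (B t)) ⊆ J)
    (hAi : Integrable A μ) (hBi : Integrable B μ)
    (hABi : Integrable (fun t => perspectiveDelta f h (A t) (B t)) μ) :
    spectrum ℝ (∫ t, B t ∂μ) ⊆ K ∧
      spectrum ℝ (opQuotient h (∫ t, A t ∂μ) (∫ t, B t ∂μ)) ⊆ J ∧
      perspectiveDelta f h (∫ t, A t ∂μ) (∫ t, B t ∂μ) ≤ perspectiveNabla μ f h A B := by
  have hK' := spectrum_integral_subset hK hBc hBsa hBK hBi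
  have hJ' := spectrum_opQuotient_integral_subset hJ hK h0J hh hpos hAc hBc hAsa hBsa hBK hAJ
    hAi hBi
  refine ⟨hK', hJ', ?_⟩
  have hconv := (perspectiveDelta_convexOn (H := H) hJ hK h0J hf hf0 hh hpos).convex_epigraph
  set E : Set (((H →L[ℂ] H) × (H →L[ℂ] H)) × (H →L[ℂ] H)) :=
    {p | p.1 ∈ perspectiveDomain J K h ∧ perspectiveDelta f h p.1.1 p.1.2 ≤ p.2} with hE
  -- The epigraph need not be closed, so averaging only places the integrated point in its closure.
  have hmem : ((∫ t, A t ∂μ, ∫ t, B t ∂μ), perspectiveNabla μ f h A B) ∈ closure E := by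
    have := hconv.closure.integral_mem (μ := μ) isClosed_closure
      (f := fun t => ((A t, B t), perspectiveDelta f h (A t) (B t)))
      (.of_forall fun t => subset_closure ⟨⟨hAsa t, hBsa t, hBK t, hAJ t⟩, le_rfl⟩)
      ((hAi.prodMk hBi).prodMk hABi)
    rwa [integral_pair (hAi.prodMk hBi) hABi, integral_pair hAi hBi] at this
  have hcont : ContinuousOn
      (fun p : ((H →L[ℂ] H) × (H →L[ℂ] H)) × (H →L[ℂ] H) =>
        p.2 - perspectiveDelta f h p.1.1 p.1.2) {p | p.1 ∈ perspectiveDomain J K h} :=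
    continuousOn_snd.sub ((continuousOn_perspectiveDelta hJ hK hf.1 hh.continuousOn hpos).comp
      continuousOn_fst fun p hp => hp)
  have hwithin := (hcont ((∫ t, A t ∂μ, ∫ t, B t ∂μ), perspectiveNabla μ f h A B)
    ⟨isSelfAdjoint_integral hAsa hAi, isSelfAdjoint_integral hBsa hBi, hK', hJ'⟩).mono
      (show E ⊆ _ from fun p hp => hp.1)
  have := hwithin.mem_closure hmem (t := Set.Ici 0) fun p hp => sub_nonneg.2 hp.2
  rw [closure_Ici] at this
  exact sub_nonneg.1 this
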